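/- Let $r$ be a prime power, let $X=\mathbf V(x_0^{r+1}+x_1^{r+1}+x_2^{r+1}+x_3^{r+1})\subset\mathbb P^3$ be the Hermitian surface over $\mathbb F_{r^2}$, and let $\mathcal S=X(\mathbb F_{r^2})=\{P_1,\dots,P_n\}$ be its set of $\mathbb F_{r^2}$-rational points. For each $i$ choose any homogeneous coordinate vector $v_i\in\mathbb F_{r^2}^4\setminus\{0\}$ of $P_i$. For an integer $h\ge 0$ let $C_h(X)\subseteq\mathbb F_{r^2}^n$ be the code consisting of all vectors $(f(v_1),\dots,f(v_n))$, where $f$ runs over the homogeneous polynomials of degree $h$ in $\mathbb F_{r^2}[x_0,x_1,x_2,x_3]$ (together with $0$). If $h<r+1$, then $C_h(X)$ has block length \[ n=(r^2+1)(r^3+1), \] dimension \[ k=\dim_{\mathbb F_{r^2}} C_h(X)=\binom{3+h}{h}, \] and its minimum distance $d$ (the least Hamming distance between two distinct codewords) satisfies \[ d\ \ge\ n-h(r+1)(r^2+1). \] -/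

import Mathlib

open scoped LinearAlgebra.Projectivization

namespace HermitianSurfaceCode

/-- The Fermat-type form `x₀^(r+1) + x₁^(r+1) + x₂^(r+1) + x₃^(r+1)`. -/
noncomputable def hermitianForm (F : Type*) [Field F] (r : ℕ) : MvPolynomial (Fin 4) F :=
  ∑ i, MvPolynomial.X i ^ (r + 1)

/-- The `F`-rational points of the Hermitian surface in projective 3-space: the points of
`ℙ³(F)` all of whose homogeneous coordinate vectors are zeros of the Hermitian form. -/
def rationalPoints (F : Type*) [Field F] (r : ℕ) : Set (ℙ F (Fin 4 → F)) :=
  {P | ∀ (v : Fin 4 → F) (hv : v ≠ 0), Projectivization.mk F v hv = P →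
    MvPolynomial.eval v (hermitianForm F r) = 0}

/-- `IsCoordinateChoice S v`: for every point of `S`, `v` selects one homogeneous
coordinate vector of that point. -/
def IsCoordinateChoice {F σ : Type*} [Field F] (S : Set (ℙ F (σ → F)))
    (v : S → σ → F) : Prop :=
  ∀ P : S, ∃ hv : v P ≠ 0, Projectivization.mk F (v P) hv = P

/-- The evaluation map `f ↦ (f(v_P))_{P ∈ ι}` on polynomials. -/
noncomputable def evalMap {F σ ι : Type*} [Field F] (v : ι → σ → F) :
    MvPolynomial σ F →ₗ[F] (ι → F) :=
  LinearMap.pi fun P => (MvPolynomial.aeval (v P)).toLinearMap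

/-- The evaluation code of the forms of degree `h`: the image under the evaluation map of the
space of homogeneous polynomials of degree `h` (including `0`). -/
noncomputable def evalCode {F σ ι : Type*} [Field F] (h : ℕ) (v : ι → σ → F) :
    Submodule F (ι → F) :=
  (MvPolynomial.homogeneousSubmodule σ F h).map (evalMap v)

open Classical in
/-- The minimum distance of a code: the least Hamming distance between two distinct
codewords. -/
noncomputable def minDist {F ι : Type*} [Field F] [Finite ι] (C : Submodule F (ι → F)) : ℕ :=
  letI := Fintype.ofFinite ι
  sInf {d | ∃ x ∈ C, ∃ y ∈ C, x ≠ y ∧ hammingDist x y = d}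

end HermitianSurfaceCode

/-!
Let `σ x = x ^ r` be the conjugation of `F`. The vanishing of `∑ xᵢ ^ (r + 1) = ∑ σ(xᵢ) xᵢ` says
that `x` is isotropic for a `σ`-sesquilinear form. Since `a ^ (r + 1) = c` has `r + 1` solutions for
every `c ≠ 0` fixed by `σ`, the number of isotropic vectors satisfies a first-order recurrence in
the number of variables. The same fibre count shows that a form of degree less than `r + 1` which
vanishes at all `x` with `x₀ ^ (r + 1) + x₁ ^ (r + 1) = 0 = x₂ ^ (r + 1) + x₃ ^ (r + 1)` is zero.

So a form `f ≠ 0` of degree `h ≤ r` is nonzero at such a point `b`, and this point lies on the line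
`L` of the surface spanned by `(b₀, b₁, 0, 0)` and `b`. As `L` is its own orthogonal complement,
every point of the surface outside `L` is orthogonal to a point of `L`, hence lies on a line of the
surface meeting `L`. Through a point `Q` of `L` there are at most `r` such lines. A line on which
`f` does not vanish identically contributes at most `h` zeros, and the number of the other lines is
at most the vanishing order of `f` along `L` at `Q`. These orders add up to at most `h`, so the
`r² + 1` points of `L` give at most `h + (r² + 1) r h + r² h = h (r + 1) (r² + 1)` zeros in all.
-/

namespace HermitianSurfaceCode

open Projectivization

section Projective

variable {F V : Type*} [Field F] [AddCommGroup V] [Module F V]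

/-- The projective points represented by the nonzero vectors of a set `S`, which need not be
closed under scalar multiplication. -/
def points (F : Type*) {V : Type*} [Field F] [AddCommGroup V] [Module F V] (S : Set V) :
    Set (ℙ F V) :=
  Projectivization.mk' F '' {x | (x : V) ∈ S}

theorem mem_points {S : Set V} {P : ℙ F V} :
    P ∈ points F S ↔ ∃ x ∈ S, ∃ hx : x ≠ 0, Projectivization.mk F x hx = P := by
  simp only [points, Set.mem_image, Set.mem_ofPred_eq, Subtype.exists, mk'_eq_mk]
  exact ⟨fun ⟨x, hx, hxS, h⟩ => ⟨x, hxS, hx, h⟩, fun ⟨x, hxS, hx, h⟩ => ⟨x, hx, hxS, h⟩⟩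

theorem points_mono {S T : Set V} (h : S ⊆ T) : points F S ⊆ points F T :=
  Set.image_mono fun _ hx => h hx

theorem points_union (S T : Set V) : points F (S ∪ T) = points F S ∪ points F T :=
  Set.image_union _ _ _

theorem points_iUnion {ι : Type*} (S : ι → Set V) :
    points F (⋃ i, S i) = ⋃ i, points F (S i) := by
  simp only [points, ← Set.image_iUnion, Set.mem_iUnion, Set.ofPred_exists]

theorem ncard_points_le_card {ι : Type*} {S : Set V} (s : Finset ι) (g : ι → V)
    (hS : ∀ x ∈ S, x ≠ 0 → ∃ i ∈ s, ∃ a : F, x = a • g i) : (points F S).ncard ≤ s.card := by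
  have hrep (P : points F S) : ∃ i : s, ∃ a : F, P.1.rep = a • g i := by
    obtain ⟨x, hxS, hx, hP⟩ := mem_points.1 P.2
    obtain ⟨i, hi, a, rfl⟩ := hS x hxS hx
    obtain ⟨c, hc⟩ := exists_smul_eq_mk_rep F _ hx
    exact ⟨⟨i, hi⟩, c * a, by rw [← hP, ← hc, Units.smul_def, smul_smul]⟩
  choose i a hia using hrep
  have hi : Function.Injective i := fun P Q hPQ => by
    have haQ : a Q ≠ 0 := fun h => Q.1.rep_nonzero (by rw [hia Q, h, zero_smul])
    rw [Subtype.ext_iff, ← P.1.mk_rep, ← Q.1.mk_rep, mk_eq_mk_iff']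
    exact ⟨a P / a Q, by rw [hia P, hia Q, hPQ, smul_smul, div_mul_cancel₀ _ haQ]⟩
  simpa using Nat.card_le_card_of_injective i hi

theorem card_nonzero_eq_card_units_mul_ncard_points {S : Set V}
    (hS : ∀ x ∈ S, ∀ a : Fˣ, a • x ∈ S) :
    Nat.card {x // x ∈ S ∧ x ≠ 0} = Nat.card Fˣ * (points F S).ncard := by
  have hrep (P : points F S) : P.1.rep ∈ S := by
    obtain ⟨x, hxS, hx, hP⟩ := mem_points.1 P.2
    obtain ⟨a, ha⟩ := exists_smul_eq_mk_rep F x hx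
    rw [← hP, ← ha]
    exact hS x hxS a
  let scale (p : Fˣ × points F S) : {x // x ∈ S ∧ x ≠ 0} :=
    ⟨p.1 • p.2.1.rep, hS _ (hrep p.2) p.1, (smul_ne_zero_iff_ne p.1).2 p.2.1.rep_nonzero⟩
  have hscale : Function.Bijective scale := by
    constructor
    · rintro ⟨a, P⟩ ⟨b, Q⟩ h
      have h' : a • P.1.rep = b • Q.1.rep := congrArg Subtype.val h
      obtain rfl : P = Q := by
        apply Subtype.ext
        rw [← P.1.mk_rep, ← Q.1.mk_rep, mk_eq_mk_iff]
        exact ⟨a⁻¹ * b, by rw [mul_smul, ← h', inv_smul_smul]⟩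
      exact congrArg (·, P) (Units.ext (smul_left_injective F P.1.rep_nonzero h'))
    · rintro ⟨x, hxS, hx⟩
      obtain ⟨a, ha⟩ := exists_smul_eq_mk_rep F x hx
      refine ⟨⟨a⁻¹, Projectivization.mk F x hx, mem_points.2 ⟨x, hxS, hx, rfl⟩⟩, ?_⟩
      exact Subtype.ext (inv_smul_eq_iff.2 ha.symm)
  rw [← Nat.card_congr (Equiv.ofBijective scale hscale), Nat.card_prod, Nat.card_coe_set_eq]

end Projective

section Conjugation

variable {F : Type*} [Field F] [Finite F] {r : ℕ}

theorem two_le_of_card_eq_sq (hF : Nat.card F = r ^ 2) : 2 ≤ r := by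
  have h : 1 < r ^ 2 := hF ▸ Finite.one_lt_card
  by_contra! hr
  interval_cases r <;> simp at h

theorem add_pow_of_card_eq_sq (hF : Nat.card F = r ^ 2) (x y : F) :
    (x + y) ^ r = x ^ r + y ^ r := by
  have := Fintype.ofFinite F
  obtain ⟨p, hp⟩ := CharP.exists F
  obtain ⟨n, hprime, hn⟩ := FiniteField.card F p
  have : Fact p.Prime := ⟨hprime⟩
  have hdvd : r ∣ p ^ (n : ℕ) := by
    rw [← hn, ← Nat.card_eq_fintype_card, hF]
    exact dvd_pow_self r two_ne_zero
  obtain ⟨m, -, rfl⟩ := (Nat.dvd_prime_pow hprime).1 hdvd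
  exact add_pow_char_pow x y p m

/-- The conjugation `x ↦ x ^ r` of the field with `r ^ 2` elements over its subfield with `r`
elements. -/
def conj (hF : Nat.card F = r ^ 2) : F →+* F where
  toFun x := x ^ r
  map_one' := one_pow r
  map_mul' x y := mul_pow x y r
  map_zero' := zero_pow (by have := two_le_of_card_eq_sq hF; omega)
  map_add' := add_pow_of_card_eq_sq hF

theorem conj_apply (hF : Nat.card F = r ^ 2) (x : F) : conj hF x = x ^ r := rfl

theorem conj_involutive (hF : Nat.card F = r ^ 2) : Function.Involutive (conj hF) := fun x => by
  have := Fintype.ofFinite F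
  rw [conj_apply, conj_apply, ← pow_mul, ← sq, ← hF, Nat.card_eq_fintype_card, FiniteField.pow_card]

theorem conj_pow_succ (hF : Nat.card F = r ^ 2) (x : F) : conj hF (x ^ (r + 1)) = x ^ (r + 1) := by
  rw [pow_succ, map_mul, ← conj_apply hF x, conj_involutive hF x, mul_comm]

theorem pow_succ_eq_conj_mul (hF : Nat.card F = r ^ 2) (x : F) : x ^ (r + 1) = conj hF x * x :=
  pow_succ x r

open Polynomial in
theorem ncard_pow_succ_eq (hF : Nat.card F = r ^ 2) {c : F} (hc : c ≠ 0) (hcr : conj hF c = c) :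
    {x : F | x ^ (r + 1) = c}.ncard = r + 1 := by
  classical
  have := Fintype.ofFinite F
  have hr := two_le_of_card_eq_sq hF
  obtain ⟨k, rfl⟩ : ∃ k, r = k + 1 := ⟨r - 1, by omega⟩
  rw [Nat.card_eq_fintype_card] at hF
  have hck : c ^ k = 1 := mul_right_cancel₀ hc (by rw [← pow_succ, one_mul]; exact hcr)
  have hdvd : (X ^ (k + 2) - C c : F[X]) ∣ X ^ Fintype.card F - X := by
    have hsub : (X ^ (k + 2) - C c : F[X]) ∣ (X ^ (k + 2)) ^ k - C c ^ k :=
      sub_dvd_pow_sub_pow _ _ _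
    rw [← C_pow, hck, C_1] at hsub
    refine hsub.trans ⟨X, ?_⟩
    rw [hF]
    ring
  have hne : (X ^ Fintype.card F - X : F[X]) ≠ 0 :=
    FiniteField.X_pow_card_sub_X_ne_zero F Fintype.one_lt_card
  have hsplits : (X ^ (k + 2) - C c : F[X]).Splits :=
    Splits.of_dvd (splits_iff_card_roots.2 (by
      rw [FiniteField.roots_X_pow_card_sub_X,
        FiniteField.X_pow_card_sub_X_natDegree_eq F Fintype.one_lt_card]
      rfl)) hne hdvd
  have hnodup : (X ^ (k + 2) - C c : F[X]).roots.Nodup := by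
    refine Multiset.nodup_of_le (roots.le_of_dvd hne hdvd) ?_
    rw [FiniteField.roots_X_pow_card_sub_X]
    exact Finset.univ.nodup
  have hset : {x : F | x ^ (k + 2) = c} = (X ^ (k + 2) - C c : F[X]).roots.toFinset := by
    ext x
    simp [mem_roots (X_pow_sub_C_ne_zero (Nat.succ_pos (k + 1)) c), sub_eq_zero]
  rw [hset, Set.ncard_coe_finset, Multiset.toFinset_card_of_nodup hnodup,
    ← hsplits.natDegree_eq_card_roots, natDegree_X_pow_sub_C]

theorem ncard_pow_succ_add_sum_eq_zero {ι : Type*} [Fintype ι] (hF : Nat.card F = r ^ 2)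
    (y : ι → F) (hy : ∑ i, y i ^ (r + 1) ≠ 0) :
    {a : F | a ^ (r + 1) + ∑ i, y i ^ (r + 1) = 0}.ncard = r + 1 := by
  simp only [← eq_neg_iff_add_eq_zero]
  refine ncard_pow_succ_eq hF (neg_ne_zero.2 hy) ?_
  simp only [map_neg, map_sum, conj_pow_succ]

end Conjugation

section IsotropicVectors

variable {F : Type*} [Field F] [Finite F] {r : ℕ}

theorem card_isotropic_succ_add (hF : Nat.card F = r ^ 2) (k : ℕ) :
    Nat.card {x : Fin (k + 1) → F // ∑ i, x i ^ (r + 1) = 0} +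
        r * Nat.card {x : Fin k → F // ∑ i, x i ^ (r + 1) = 0} =
      (r + 1) * (r ^ 2) ^ k := by
  classical
  have := Fintype.ofFinite F
  have hfiber (y : Fin k → F) :
      Nat.card {a : F // a ^ (r + 1) + ∑ i, y i ^ (r + 1) = 0} +
        r * (if ∑ i, y i ^ (r + 1) = 0 then 1 else 0) = r + 1 := by
    split_ifs with hy
    · simp [hy, add_comm]
    · rw [mul_zero, add_zero]
      exact ncard_pow_succ_add_sum_eq_zero hF y hy
  let e : {x : Fin (k + 1) → F // ∑ i, x i ^ (r + 1) = 0} ≃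
      Σ y : Fin k → F, {a : F // a ^ (r + 1) + ∑ i, y i ^ (r + 1) = 0} :=
    { toFun x := ⟨Fin.tail x.1, x.1 0, by simpa [Fin.sum_univ_succ, Fin.tail] using x.2⟩
      invFun p := ⟨Fin.cons p.2.1 p.1, by simpa [Fin.sum_univ_succ] using p.2.2⟩
      left_inv x := Subtype.ext (Fin.cons_self_tail x.1)
      right_inv _ := rfl }
  have hbase : Nat.card {x : Fin k → F // ∑ i, x i ^ (r + 1) = 0} =
      ∑ y : Fin k → F, if ∑ i, y i ^ (r + 1) = 0 then 1 else 0 := by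
    rw [Nat.card_eq_fintype_card, Fintype.card_subtype, Finset.card_filter]
  rw [Nat.card_congr e, Nat.card_sigma, hbase, Finset.mul_sum, ← Finset.sum_add_distrib,
    Finset.sum_congr rfl fun y _ => hfiber y, Finset.sum_const, Finset.card_univ,
    ← Nat.card_eq_fintype_card, Nat.card_fun, hF, Nat.card_fin, smul_eq_mul, mul_comm]

theorem card_isotropic (hF : Nat.card F = r ^ 2) (k : ℕ) :
    (Nat.card {x : Fin (k + 1) → F // ∑ i, x i ^ (r + 1) = 0} : ℤ) =
      r ^ (2 * k + 1) + (-1) ^ (k + 1) * (r - 1) * r ^ k := by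
  induction k with
  | zero =>
    have h := card_isotropic_succ_add hF 0
    simp only [Finset.univ_eq_empty, Finset.sum_empty, Nat.card_eq_fintype_card,
      Fintype.card_subtype_true, Fintype.card_unique] at h
    zify at h
    linear_combination h
  | succ k ih =>
    have h := card_isotropic_succ_add hF (k + 1)
    zify at h
    rw [ih] at h
    linear_combination h

end IsotropicVectors

section RationalPoints

variable {F : Type*} [Field F] {r : ℕ}

theorem rationalPoints_eq_points :
    rationalPoints F r = points F {x : Fin 4 → F | ∑ i, x i ^ (r + 1) = 0} := by
  have heval (x : Fin 4 → F) : MvPolynomial.eval x (hermitianForm F r) = ∑ i, x i ^ (r + 1) := by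
    simp [hermitianForm]
  ext P
  simp only [rationalPoints, Set.mem_ofPred_eq, mem_points, heval]
  constructor
  · exact fun h => ⟨P.rep, h _ P.rep_nonzero P.mk_rep, P.rep_nonzero, P.mk_rep⟩
  · rintro ⟨x, hx, hx0, rfl⟩ y hy0 hyx
    obtain ⟨a, rfl⟩ := (mk_eq_mk_iff' F y x hy0 hx0).1 hyx
    simp [mul_pow, ← Finset.mul_sum, hx]

theorem card_rationalPoints [Finite F] (hF : Nat.card F = r ^ 2) :
    Nat.card (rationalPoints F r) = (r ^ 2 + 1) * (r ^ 3 + 1) := by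
  have hcount := card_nonzero_eq_card_units_mul_ncard_points (F := F)
    (S := {x : Fin 4 → F | ∑ i, x i ^ (r + 1) = 0})
    fun x hx a => by simp_all [Units.smul_def, mul_pow, ← Finset.mul_sum]
  rw [← rationalPoints_eq_points, ← Nat.card_coe_set_eq] at hcount
  have hinsert : {x : Fin 4 → F | ∑ i, x i ^ (r + 1) = 0} =
      insert 0 {x | x ∈ {x : Fin 4 → F | ∑ i, x i ^ (r + 1) = 0} ∧ x ≠ 0} := by
    ext x
    by_cases hx : x = 0 <;> simp [hx]
  have hvectors : Nat.card {x : Fin 4 → F // ∑ i, x i ^ (r + 1) = 0} =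
      Nat.card Fˣ * Nat.card (rationalPoints F r) + 1 := by
    rw [← hcount]
    exact (congrArg Set.ncard hinsert).trans (Set.ncard_insert_of_notMem (by simp))
  have hcard := card_isotropic hF 3
  have hr : 1 < r ^ 2 := hF ▸ Finite.one_lt_card
  rw [hvectors, Nat.card_units, hF] at hcard
  push_cast [hr.le] at hcard
  have hr' : (r : ℤ) ^ 2 - 1 ≠ 0 := by
    have : (1 : ℤ) < r ^ 2 := by exact_mod_cast hr
    omega
  zify
  apply mul_left_cancel₀ hr'
  linear_combination hcard

end RationalPoints

section DeterminingSets

variable {R : Type*}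

/-- A set of points determines the polynomials of degree at most `h` if only the zero polynomial
among them vanishes on the set. -/
def IsDetermining {ι : Type*} [CommSemiring R] (h : ℕ) (S : Set (ι → R)) : Prop :=
  ∀ f : MvPolynomial ι R, f.totalDegree ≤ h → (∀ x ∈ S, MvPolynomial.eval x f = 0) → f = 0

theorem isDetermining_univ_of_isEmpty {ι : Type*} [CommSemiring R] [IsEmpty ι] (h : ℕ) :
    IsDetermining h (Set.univ : Set (ι → R)) := fun f _ hf => by
  rw [MvPolynomial.eq_C_of_isEmpty f] at hf ⊢
  simpa using hf isEmptyElim trivial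

theorem IsDetermining.of_fiber [CommRing R] [IsDomain R] {n h : ℕ} {S : Set (Fin n → R)}
    {T : Set (Fin (n + 1) → R)} (hS : IsDetermining h S)
    (hT : ∀ y ∈ S, ∃ s : Finset R, h < s.card ∧ ∀ a ∈ s, (Fin.cons a y : Fin (n + 1) → R) ∈ T) :
    IsDetermining h T := by
  intro f hf hfT
  apply (MvPolynomial.finSuccEquiv R n).injective
  rw [map_zero]
  ext1 i
  rw [Polynomial.coeff_zero]
  by_contra hi
  have hdeg := MvPolynomial.totalDegree_coeff_finSuccEquiv_add_le f i hi
  refine hi (hS _ (by omega) fun y hy => ?_)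
  obtain ⟨s, hs, hsT⟩ := hT y hy
  have hfiber : (MvPolynomial.finSuccEquiv R n f).map (MvPolynomial.eval y) = 0 := by
    refine Polynomial.eq_zero_of_natDegree_lt_card_of_eval_eq_zero' _ s (fun a ha => ?_) ?_
    · rw [← MvPolynomial.eval_eq_eval_mv_eval']
      exact hfT _ (hsT a ha)
    · refine (Polynomial.natDegree_map_le.trans ?_).trans_lt hs
      rw [MvPolynomial.natDegree_finSuccEquiv]
      exact (MvPolynomial.degreeOf_le_totalDegree f 0).trans hf
  rw [← Polynomial.coeff_map, hfiber, Polynomial.coeff_zero]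

variable {F : Type*} [Field F] [Finite F] {r h : ℕ}

theorem IsDetermining.cons_cons (hF : Nat.card F = r ^ 2) (hh : h < r + 1) {n : ℕ}
    {S : Set (Fin n → F)} (hS : IsDetermining h S) :
    IsDetermining h {x : Fin (n + 2) → F |
      x 1 ≠ 0 ∧ x 0 ^ (r + 1) + x 1 ^ (r + 1) = 0 ∧ Fin.tail (Fin.tail x) ∈ S} := by
  classical
  have := Fintype.ofFinite F
  have hr := two_le_of_card_eq_sq hF
  have hunits : h < (Finset.univ.erase (0 : F)).card := by
    rw [Finset.card_erase_of_mem (Finset.mem_univ _), Finset.card_univ,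
      ← Nat.card_eq_fintype_card, hF]
    have : r + 2 ≤ r ^ 2 := by nlinarith
    omega
  have hcons : IsDetermining h {y : Fin (n + 1) → F | y 0 ≠ 0 ∧ Fin.tail y ∈ S} :=
    hS.of_fiber fun y hy => ⟨_, hunits, fun a ha => ⟨Finset.ne_of_mem_erase ha, hy⟩⟩
  refine hcons.of_fiber fun y hy => ?_
  let s : Finset F := {a | a ^ (r + 1) + y 0 ^ (r + 1) = 0}
  have hs : s.card = r + 1 := by
    have h := ncard_pow_succ_add_sum_eq_zero (ι := Unit) hF (fun _ => y 0) (by simpa using hy.1)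
    rw [← Set.ncard_coe_finset]
    simpa [s] using h
  exact ⟨s, hs ▸ hh, fun a ha => ⟨hy.1, by simpa [s] using ha, hy.2⟩⟩

theorem exists_eval_ne_zero (hF : Nat.card F = r ^ 2) (hh : h < r + 1) {f : MvPolynomial (Fin 4) F}
    (hf : f.totalDegree ≤ h) (hf0 : f ≠ 0) :
    ∃ b : Fin 4 → F, b 1 ≠ 0 ∧ b 0 ^ (r + 1) + b 1 ^ (r + 1) = 0 ∧
      b 3 ≠ 0 ∧ b 2 ^ (r + 1) + b 3 ^ (r + 1) = 0 ∧ MvPolynomial.eval b f ≠ 0 := by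
  by_contra! hzero
  have hdet := ((isDetermining_univ_of_isEmpty (ι := Fin 0) h).cons_cons hF hh).cons_cons hF hh
  exact hf0 (hdet f hf fun b ⟨h1, h01, h3, h23, _⟩ => hzero b h1 h01 h3 h23)

end DeterminingSets

section RestrictLine

variable {R ι : Type*} [CommSemiring R]

/-- The restriction `t ↦ f (x + t y)` of `f` to the line through `x` with direction `y`, as a
polynomial in `t`. For a form `f`, this is its restriction to the projective line joining `x` and
`y`, in the affine chart around `x` that omits `y`. -/
noncomputable def restrictLine (f : MvPolynomial ι R) (x y : ι → R) : Polynomial R :=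
  f.eval₂ Polynomial.C fun i => Polynomial.C (x i) + Polynomial.X * Polynomial.C (y i)

theorem eval_restrictLine (f : MvPolynomial ι R) (x y : ι → R) (t : R) :
    (restrictLine f x y).eval t = MvPolynomial.eval (x + t • y) f := by
  rw [restrictLine, ← Polynomial.coe_evalRingHom, MvPolynomial.eval₂_comp_left]
  congr 1
  · ext; simp
  · ext1 i
    simp [mul_comm t]

theorem map_restrictLine {S : Type*} [CommSemiring S] (φ : R →+* S) (f : MvPolynomial ι R)
    (x y : ι → R) :
    (restrictLine f x y).map φ = restrictLine (MvPolynomial.map φ f) (φ ∘ x) (φ ∘ y) := by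
  rw [restrictLine, ← Polynomial.coe_mapRingHom, MvPolynomial.eval₂_comp_left, restrictLine,
    MvPolynomial.eval₂_map]
  congr 1
  · ext; simp
  · ext; simp

theorem eval_map_C_eq_restrictLine (f : MvPolynomial ι R) (x y : ι → R) :
    MvPolynomial.eval (fun i => Polynomial.C (x i) + Polynomial.X * Polynomial.C (y i))
      (MvPolynomial.map Polynomial.C f) = restrictLine f x y := by
  rw [MvPolynomial.eval_map]
  rfl

theorem restrictLine_comp_X_add_C (f : MvPolynomial ι R) (x y : ι → R) (t : R) :
    (restrictLine f x y).comp (Polynomial.X + Polynomial.C t) = restrictLine f (x + t • y) y := by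
  rw [restrictLine, ← Polynomial.coe_compRingHom_apply, MvPolynomial.eval₂_comp_left]
  congr 1
  · ext; simp
  · ext1 i
    simp only [Polynomial.coe_compRingHom, Function.comp_apply, Polynomial.add_comp,
      Polynomial.mul_comp, Polynomial.C_comp, Polynomial.X_comp, Pi.add_apply, Pi.smul_apply,
      smul_eq_mul, map_add, map_mul]
    ring

theorem natDegree_restrictLine_le (f : MvPolynomial ι R) (x y : ι → R) :
    (restrictLine f x y).natDegree ≤ f.totalDegree := by
  rw [← mul_one f.totalDegree]
  exact MvPolynomial.aeval_natDegree_le f le_rfl _ fun i => by compute_degree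

theorem eval_smul_of_isHomogeneous {f : MvPolynomial ι R} {h : ℕ} (hf : f.IsHomogeneous h) (a : R)
    (x : ι → R) : MvPolynomial.eval (a • x) f = a ^ h * MvPolynomial.eval x f := by
  rw [MvPolynomial.eval_eq, MvPolynomial.eval_eq, Finset.mul_sum]
  refine Finset.sum_congr rfl fun d hd => ?_
  simp only [Pi.smul_apply, smul_eq_mul, mul_pow, Finset.prod_mul_distrib,
    Finset.prod_pow_eq_pow_sum, hf.degree_eq_sum_deg_support hd]
  ring

variable {F : Type*} [Field F]

theorem restrictLine_swap_eq_zero {f : MvPolynomial ι F} {h : ℕ} (hf : f.IsHomogeneous h)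
    {x y : ι → F} (hxy : restrictLine f x y = 0) : restrictLine f y x = 0 := by
  -- A nonzero polynomial may vanish on a finite field, so the identity
  -- `f (y + t x) = t ^ h f (x + t⁻¹ y)` is evaluated over the algebraic closure.
  let φ := algebraMap F (AlgebraicClosure F)
  apply Polynomial.map_injective φ φ.injective
  rw [Polynomial.map_zero]
  refine Polynomial.eq_zero_of_infinite_isRoot _
    ((Set.finite_singleton (0 : AlgebraicClosure F)).infinite_compl.mono fun t ht => ?_)
  have hsmul : φ ∘ y + t • φ ∘ x = t • (φ ∘ x + t⁻¹ • φ ∘ y) := by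
    rw [smul_add, smul_inv_smul₀ ht, add_comm]
  rw [Set.mem_ofPred_eq, Polynomial.IsRoot, map_restrictLine, eval_restrictLine, hsmul,
    eval_smul_of_isHomogeneous (hf.map φ), ← eval_restrictLine, ← map_restrictLine, hxy,
    Polynomial.map_zero, Polynomial.eval_zero, mul_zero]

theorem restrictLine_ne_zero {f : MvPolynomial ι F} {h : ℕ} (hf : f.IsHomogeneous h) {y : ι → F}
    (hy : MvPolynomial.eval y f ≠ 0) (x : ι → F) : restrictLine f x y ≠ 0 := fun hxy => hy <| by
  simpa [restrictLine_swap_eq_zero hf hxy] using (eval_restrictLine f y x 0).symm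

theorem ncard_zeros_line_le {f : MvPolynomial ι F} {x y : ι → F} (hxy : restrictLine f x y ≠ 0) :
    {t : F | MvPolynomial.eval (x + t • y) f = 0}.ncard ≤ f.totalDegree := by
  classical
  have hset : {t : F | MvPolynomial.eval (x + t • y) f = 0} =
      (restrictLine f x y).roots.toFinset := by
    ext t
    simp [hxy, eval_restrictLine]
  rw [hset, Set.ncard_coe_finset]
  exact (Multiset.toFinset_card_le _).trans
    ((Polynomial.card_roots' _).trans (natDegree_restrictLine_le f x y))

theorem card_le_rootMultiplicity_restrictLine {f : MvPolynomial ι F} {x y z : ι → F}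
    (hxy : restrictLine f x y ≠ 0) (s : Finset F)
    (hs : ∀ c ∈ s, restrictLine f x (c • y + z) = 0) :
    s.card ≤ (restrictLine f x y).rootMultiplicity 0 := by
  -- As a polynomial in `s` over `F[t]`, `p = f (x + t z + s y)` is divisible by `∏ (s - c t)`;
  -- setting `t = 0` makes this product a power of `s`.
  let p : Polynomial (Polynomial F) := restrictLine (MvPolynomial.map Polynomial.C f)
    (fun i => Polynomial.C (x i) + Polynomial.X * Polynomial.C (z i)) (Polynomial.C ∘ y)
  have hmap : p.map (Polynomial.evalRingHom 0) = restrictLine f x y := by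
    have hid : (Polynomial.evalRingHom 0).comp Polynomial.C = RingHom.id F := by ext; simp
    rw [map_restrictLine, MvPolynomial.map_map, hid, MvPolynomial.map_id]
    congr 1 <;> ext <;> simp
  have hroot (c : F) (hc : c ∈ s) : p.IsRoot (Polynomial.X * Polynomial.C c) := by
    rw [Polynomial.IsRoot, eval_restrictLine, ← hs c hc, ← eval_map_C_eq_restrictLine]
    congr 2
    ext1 i
    simp only [Pi.add_apply, Pi.smul_apply, Function.comp_apply, smul_eq_mul, map_add, map_mul]
    ring
  have hp : p ≠ 0 := fun hp => hxy (by rw [← hmap, hp, Polynomial.map_zero])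
  have hinj : Function.Injective fun c : F => (Polynomial.X * Polynomial.C c : Polynomial F) :=
    (mul_right_injective₀ Polynomial.X_ne_zero).comp Polynomial.C_injective
  have hroots : (s.map ⟨_, hinj⟩).val ≤ p.roots :=
    Finset.val_le_iff_val_subset.2 fun q hq => by
      obtain ⟨c, hc, rfl⟩ := Finset.mem_map.1 hq
      exact (Polynomial.mem_roots hp).2 (hroot c hc)
  have hdvd := Polynomial.map_dvd (Polynomial.evalRingHom 0)
    ((Multiset.prod_X_sub_C_dvd_iff_le_roots hp _).2 hroots)
  rw [hmap, ← Finset.prod_eq_multiset_prod, Finset.prod_map, Polynomial.map_prod] at hdvd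
  rw [Polynomial.le_rootMultiplicity_iff hxy]
  simpa using hdvd

theorem sum_rootMultiplicity_le_natDegree [Fintype F] (p : Polynomial F) :
    ∑ t, p.rootMultiplicity t ≤ p.natDegree := by
  classical
  simp_rw [← Polynomial.count_roots]
  rw [Multiset.sum_count_eq_card fun a _ => Finset.mem_univ a]
  exact Polynomial.card_roots' p

end RestrictLine

section SesquilinearForm

theorem span_add_smul_pair {R M : Type*} [CommRing R] [AddCommGroup M] [Module R M] (x y : M)
    (a : R) : Submodule.span R {x + a • y, y} = Submodule.span R {x, y} := by
  ext z
  simp only [Submodule.mem_span_pair]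
  constructor
  · rintro ⟨b, c, rfl⟩
    exact ⟨b, b * a + c, by module⟩
  · rintro ⟨b, c, rfl⟩
    exact ⟨b, c - b * a, by module⟩

variable {F V : Type*} [Field F] [AddCommGroup V] [Module F V] {σ : F →+* F}
  {B : V →ₛₗ[σ] V →ₗ[F] F} {L : Submodule F V} {u w : V}

theorem mem_iff_of_orthogonalBilin_eq (hL : L.orthogonalBilin B = L)
    (huw : Submodule.span F {u, w} = L) {x : V} : x ∈ L ↔ B u x = 0 ∧ B w x = 0 := by
  rw [← hL, Submodule.mem_orthogonalBilin_iff, ← huw]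
  constructor
  · exact fun h => ⟨h u (Submodule.subset_span (by simp)), h w (Submodule.subset_span (by simp))⟩
  · rintro ⟨hu, hw⟩ y hy
    obtain ⟨a, b, rfl⟩ := Submodule.mem_span_pair.1 hy
    simp [hu, hw]

theorem exists_eq_smul_of_apply_eq_zero (hL : L.orthogonalBilin B = L)
    (huw : Submodule.span F {u, w} = L) {x z : V} (hux : B u x = 0) (huz : B u z = 0)
    (hx : x ∉ L) (hz : z ∉ L) : ∃ c t d : F, d ≠ 0 ∧ x = d • (c • w + z + t • u) := by
  rw [mem_iff_of_orthogonalBilin_eq hL huw] at hx hz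
  have hwx : B w x ≠ 0 := fun h => hx ⟨hux, h⟩
  have hwz : B w z ≠ 0 := fun h => hz ⟨huz, h⟩
  obtain ⟨d, hd⟩ : ∃ d, d = B w x / B w z := ⟨_, rfl⟩
  have hd0 : d ≠ 0 := hd ▸ div_ne_zero hwx hwz
  have hmem : x - d • z ∈ L := by
    rw [mem_iff_of_orthogonalBilin_eq hL huw]
    simp [hux, huz, hd, hwz]
  rw [← huw, Submodule.mem_span_pair] at hmem
  obtain ⟨a, b, hab⟩ := hmem
  refine ⟨d⁻¹ * b, d⁻¹ * a, d, hd0, ?_⟩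
  simp only [smul_add, mul_smul, smul_inv_smul₀ hd0]
  rw [sub_eq_iff_eq_add.1 hab.symm]
  abel

theorem apply_self_smul_add_smul (hB : B.IsRefl) {y : V} (huu : B u u = 0) (huy : B u y = 0)
    (d t : F) : B (d • (y + t • u)) (d • (y + t • u)) = σ d * (d * B y y) := by
  simp [huu, huy, hB _ _ huy]

theorem ncard_isotropic_le {r : ℕ} (hr : 2 ≤ r) (hσ : ∀ a, σ a = a ^ r) {z : V} (hww : B w w = 0)
    (hwz : B w z ≠ 0) : {c : F | B (c • w + z) (c • w + z) = 0}.ncard ≤ r := by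
  classical
  let p : Polynomial F := Polynomial.C (B w z) * Polynomial.X ^ r +
    Polynomial.C (B z w) * Polynomial.X + Polynomial.C (B z z)
  have hp : p ≠ 0 := fun h => hwz <| by
    have hcoeff : p.coeff r = B w z := by
      simp [p, Polynomial.coeff_X, Polynomial.coeff_C, show (1 : ℕ) ≠ r by omega,
        show r ≠ 0 by omega]
    rw [← hcoeff, h, Polynomial.coeff_zero]
  have hdeg : p.natDegree ≤ r := by
    have : 1 ≤ r := by omega
    simp only [p]
    compute_degree!
  have hsub : {c : F | B (c • w + z) (c • w + z) = 0} ⊆ p.roots.toFinset := fun c hc => by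
    rw [Finset.mem_coe, Multiset.mem_toFinset, Polynomial.mem_roots hp, Polynomial.IsRoot, ← hc]
    simp only [p, Polynomial.eval_add, Polynomial.eval_mul, Polynomial.eval_C, Polynomial.eval_pow,
      Polynomial.eval_X, map_add, map_smul, LinearMap.map_smulₛₗ, hσ, LinearMap.add_apply,
      LinearMap.smul_apply, hww, smul_eq_mul, mul_zero, zero_add]
    ring
  calc _ ≤ p.roots.toFinset.card :=
        (Set.ncard_le_ncard hsub).trans_eq (Set.ncard_coe_finset _)
    _ ≤ r := (Multiset.toFinset_card_le _).trans ((Polynomial.card_roots' p).trans hdeg)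

end SesquilinearForm

section Zeros

variable {F ι : Type*} [Field F] {σ : F →+* F} {B : (ι → F) →ₛₗ[σ] (ι → F) →ₗ[F] F}
  {L : Submodule F (ι → F)} {u w : ι → F} {f : MvPolynomial ι F} {h : ℕ}

/-- The zeros of `f` on the lines of the variety `B x x = 0` that pass through `y` and differ from
the line `L` of this variety; the vectors of `L` itself are left out. -/
def pencilZeros (B : (ι → F) →ₛₗ[σ] (ι → F) →ₗ[F] F) (L : Submodule F (ι → F))
    (f : MvPolynomial ι F) (y : ι → F) : Set (ι → F) :=
  {x | x ∉ L ∧ B y x = 0 ∧ B x x = 0 ∧ MvPolynomial.eval x f = 0}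

open Classical in
theorem ncard_points_pencilZeros_le_sum [Fintype F] (hB : B.IsRefl) (hL : L.orthogonalBilin B = L)
    (huw : Submodule.span F {u, w} = L) (hf : f.IsHomogeneous h) {z : ι → F} (huz : B u z = 0)
    (hz : z ∉ L) :
    (points F (pencilZeros B L f u)).ncard ≤ ∑ c : F with B (c • w + z) (c • w + z) = 0,
      {t : F | MvPolynomial.eval (c • w + z + t • u) f = 0}.ncard := by
  obtain ⟨huu, hwu⟩ :=
    (mem_iff_of_orthogonalBilin_eq hL huw).1 (huw ▸ Submodule.subset_span (by simp) : u ∈ L)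
  let zeros (c : F) : Finset F := {t | MvPolynomial.eval (c • w + z + t • u) f = 0}
  have hzeros (c : F) :
      {t : F | MvPolynomial.eval (c • w + z + t • u) f = 0}.ncard = (zeros c).card := by
    simp [zeros, ← Set.ncard_coe_finset]
  simp only [hzeros]
  rw [← Finset.card_sigma]
  refine ncard_points_le_card _ (fun p => p.1 • w + z + p.2 • u) ?_
  rintro x ⟨hx, hux, hxx, hfx⟩ -
  obtain ⟨c, t, d, hd, rfl⟩ := exists_eq_smul_of_apply_eq_zero hL huw hux huz hx hz
  refine ⟨⟨c, t⟩, Finset.mem_sigma.2 ⟨?_, ?_⟩, d, rfl⟩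
  · rw [apply_self_smul_add_smul hB huu (by simp [hB _ _ hwu, huz])] at hxx
    simpa [hd] using hxx
  · rw [eval_smul_of_isHomogeneous hf] at hfx
    simpa [zeros, hd] using hfx

theorem ncard_points_pencilZeros_le [Finite F] {r : ℕ} (hr : 2 ≤ r) (hσ : ∀ a, σ a = a ^ r)
    (hB : B.IsRefl) (hL : L.orthogonalBilin B = L) (huw : Submodule.span F {u, w} = L)
    (hf : f.IsHomogeneous h) (hfuw : restrictLine f u w ≠ 0) :
    (points F (pencilZeros B L f u)).ncard ≤
      r * h + Nat.card F * (restrictLine f u w).rootMultiplicity 0 := by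
  classical
  have := Fintype.ofFinite F
  by_cases! hz : ∀ z, B u z = 0 → z ∈ L
  · have hempty : pencilZeros B L f u = ∅ :=
      Set.eq_empty_of_forall_notMem fun x hx => hx.1 (hz x hx.2.1)
    simp [hempty, points]
  obtain ⟨z, huz, hzL⟩ := hz
  have hwz : B w z ≠ 0 := fun h => hzL ((mem_iff_of_orthogonalBilin_eq hL huw).2 ⟨huz, h⟩)
  have hww : B w w = 0 :=
    ((mem_iff_of_orthogonalBilin_eq hL huw).1 (huw ▸ Submodule.subset_span (by simp))).2
  let lines : Finset F := {c | B (c • w + z) (c • w + z) = 0}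
  have hlines : lines.card ≤ r := by
    simpa [lines, ← Set.ncard_coe_finset] using ncard_isotropic_le hr hσ hww hwz
  have hbad := card_le_rootMultiplicity_restrictLine hfuw (z := z)
    {c ∈ lines | restrictLine f u (c • w + z) = 0} fun c hc => (Finset.mem_filter.1 hc).2
  have hzeros (c : F) : {t : F | MvPolynomial.eval (c • w + z + t • u) f = 0}.ncard ≤
      h + if restrictLine f u (c • w + z) = 0 then Nat.card F else 0 := by
    split_ifs with hc
    · exact (Set.ncard_le_card _).trans (Nat.le_add_left _ _)
    · exact (ncard_zeros_line_le (mt (restrictLine_swap_eq_zero hf) hc)).trans hf.totalDegree_le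
  calc _ ≤ _ := ncard_points_pencilZeros_le_sum hB hL huw hf huz hzL
    _ ≤ _ := Finset.sum_le_sum fun c _ => hzeros c
    _ = lines.card * h + Nat.card F *
        Finset.card {c ∈ lines | restrictLine f u (c • w + z) = 0} := by
      rw [Finset.sum_add_distrib, Finset.sum_const, ← Finset.sum_filter, Finset.sum_const,
        smul_eq_mul, smul_eq_mul, mul_comm (Finset.card _) (Nat.card F)]
    _ ≤ _ := by gcongr

theorem ncard_points_zeros_mem_le [Finite F] (huw : Submodule.span F {u, w} = L)
    (hf : f.IsHomogeneous h) (hfw : MvPolynomial.eval w f ≠ 0) :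
    (points F {x | x ∈ L ∧ MvPolynomial.eval x f = 0}).ncard ≤ h := by
  classical
  have := Fintype.ofFinite F
  let zeros : Finset F := {t | MvPolynomial.eval (u + t • w) f = 0}
  have hzeros : zeros.card ≤ h := by
    have := ncard_zeros_line_le (restrictLine_ne_zero hf hfw u)
    refine le_trans ?_ (this.trans hf.totalDegree_le)
    simp [zeros, ← Set.ncard_coe_finset]
  refine (ncard_points_le_card zeros (fun t => u + t • w) ?_).trans hzeros
  rintro x ⟨hxL, hfx⟩ hx
  rw [← huw, Submodule.mem_span_pair] at hxL
  obtain ⟨a, b, rfl⟩ := hxL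
  have ha : a ≠ 0 := by
    rintro rfl
    rw [zero_smul, zero_add, eval_smul_of_isHomogeneous hf, mul_eq_zero, or_iff_left hfw] at hfx
    exact hx (by simp [eq_zero_of_pow_eq_zero hfx])
  have hxa : a • u + b • w = a • (u + (b / a) • w) := by
    rw [smul_add, smul_smul, mul_div_cancel₀ b ha]
  rw [hxa, eval_smul_of_isHomogeneous hf] at hfx
  exact ⟨b / a, by simpa [zeros, ha] using hfx, a, hxa⟩

theorem exists_apply_add_smul_eq_zero [Finite F] {x : ι → F} (hwx : B w x ≠ 0) :
    ∃ t : F, B (u + t • w) x = 0 := by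
  obtain ⟨t, ht⟩ := Finite.surjective_of_injective σ.injective (-B u x / B w x)
  exact ⟨t, by simp [ht, hwx]⟩

theorem isotropic_zeros_subset [Finite F] (w : ι → F) :
    {x | B x x = 0 ∧ MvPolynomial.eval x f = 0} ⊆ {x | x ∈ L ∧ MvPolynomial.eval x f = 0} ∪
      (pencilZeros B L f w ∪ ⋃ t : F, pencilZeros B L f (u + t • w)) := by
  rintro x ⟨hxx, hfx⟩
  by_cases hxL : x ∈ L
  · exact Or.inl ⟨hxL, hfx⟩
  by_cases hwx : B w x = 0
  · exact Or.inr (Or.inl ⟨hxL, hwx, hxx, hfx⟩)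
  · obtain ⟨t, ht⟩ := exists_apply_add_smul_eq_zero (u := u) hwx
    exact Or.inr (Or.inr (Set.mem_iUnion.2 ⟨t, hxL, ht, hxx, hfx⟩))

theorem ncard_points_isotropic_zeros_le [Finite F] [Finite ι] {r : ℕ} (hr : 2 ≤ r)
    (hσ : ∀ a, σ a = a ^ r) (hB : B.IsRefl) (hL : L.orthogonalBilin B = L)
    (huw : Submodule.span F {u, w} = L) (hf : f.IsHomogeneous h) (hfw : MvPolynomial.eval w f ≠ 0) :
    (points F {x | B x x = 0 ∧ MvPolynomial.eval x f = 0}).ncard ≤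
      h * (r + 1) * (Nat.card F + 1) := by
  have := Fintype.ofFinite F
  let m (t : F) : ℕ := (restrictLine f u w).rootMultiplicity t
  have hpencil_w : (points F (pencilZeros B L f w)).ncard ≤ r * h := by
    have hroot : (restrictLine f w u).eval 0 ≠ 0 := by simpa [eval_restrictLine] using hfw
    have hle := ncard_points_pencilZeros_le hr hσ hB hL ((Set.pair_comm w u).symm ▸ huw) hf
      fun h => hroot (by simp [h])
    rwa [Polynomial.rootMultiplicity_eq_zero hroot, mul_zero, add_zero] at hle
  have hpencil (t : F) : (points F (pencilZeros B L f (u + t • w))).ncard ≤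
      r * h + Nat.card F * m t := by
    have hspan : Submodule.span F {u + t • w, w} = L := by
      rw [span_add_smul_pair, huw]
    simp only [m]
    rw [Polynomial.rootMultiplicity_eq_rootMultiplicity, restrictLine_comp_X_add_C]
    exact ncard_points_pencilZeros_le hr hσ hB hL hspan hf (restrictLine_ne_zero hf hfw _)
  have hsum : ∑ t, m t ≤ h :=
    (sum_rootMultiplicity_le_natDegree _).trans
      ((natDegree_restrictLine_le f u w).trans hf.totalDegree_le)
  calc _ ≤ _ := Set.ncard_le_ncard (points_mono (isotropic_zeros_subset (L := L) (u := u) w))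
    _ ≤ (points F {x | x ∈ L ∧ MvPolynomial.eval x f = 0}).ncard +
        ((points F (pencilZeros B L f w)).ncard +
          ∑ t, (points F (pencilZeros B L f (u + t • w))).ncard) := by
      rw [points_union, points_union, points_iUnion]
      grw [Set.ncard_union_le, Set.ncard_union_le, Set.ncard_iUnion_le_of_fintype]
    _ ≤ h + (r * h + ∑ t, (r * h + Nat.card F * m t)) := by
      gcongr with t
      · exact ncard_points_zeros_mem_le huw hf hfw
      · exact hpencil t
    _ = h + r * h + Nat.card F * (r * h) + Nat.card F * ∑ t, m t := by
      rw [Finset.sum_add_distrib, Finset.mul_sum, Finset.sum_const, Finset.card_univ,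
        ← Nat.card_eq_fintype_card, smul_eq_mul, add_assoc, add_assoc]
    _ ≤ h + r * h + Nat.card F * (r * h) + Nat.card F * h := by gcongr
    _ = h * (r + 1) * (Nat.card F + 1) := by ring

end Zeros

section HermitianPairing

/-- The standard pairing `∑ σ(xᵢ) yᵢ`, semilinear in the first argument. For the conjugation `σ` of
the field with `r ^ 2` elements its isotropic vectors are the zeros of `hermitianForm`. -/
def hermitianPairing {R ι : Type*} [CommSemiring R] [Fintype ι] (σ : R →+* R) :
    (ι → R) →ₛₗ[σ] (ι → R) →ₗ[R] R :=
  LinearMap.mk₂'ₛₗ σ (RingHom.id R) (fun x y => ∑ i, σ (x i) * y i)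
    (by simp [add_mul, Finset.sum_add_distrib]) (by simp [mul_assoc, Finset.mul_sum])
    (by simp [mul_add, Finset.sum_add_distrib]) (by simp [mul_left_comm, Finset.mul_sum])

theorem hermitianPairing_apply {R ι : Type*} [CommSemiring R] [Fintype ι] (σ : R →+* R)
    (x y : ι → R) : hermitianPairing σ x y = ∑ i, σ (x i) * y i := rfl

theorem isSymm_hermitianPairing {R ι : Type*} [CommSemiring R] [Fintype ι] {σ : R →+* R}
    (hσ : Function.Involutive σ) : (hermitianPairing σ : (ι → R) →ₛₗ[σ] _ →ₗ[R] R).IsSymm :=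
  ⟨fun x y => by simp [hermitianPairing_apply, hσ _, mul_comm]⟩

variable {F : Type*} [Field F]

theorem eq_div_mul_of_isotropic {σ : F →+* F} {a b x y : F} (hb : b ≠ 0)
    (hab : σ a * a + σ b * b = 0) (hxy : σ a * x + σ b * y = 0) : x = y / b * a := by
  have hσb : σ b ≠ 0 := (map_ne_zero σ).2 hb
  rw [div_mul_eq_mul_div, eq_div_iff hb]
  apply mul_left_cancel₀ hσb
  linear_combination x * hab - a * hxy

theorem orthogonalBilin_span_pair_eq {σ : F →+* F} {b : Fin 4 → F} (h1 : b 1 ≠ 0)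
    (h01 : σ (b 0) * b 0 + σ (b 1) * b 1 = 0) (h3 : b 3 ≠ 0)
    (h23 : σ (b 2) * b 2 + σ (b 3) * b 3 = 0) :
    (Submodule.span F {![b 0, b 1, 0, 0], b}).orthogonalBilin (hermitianPairing σ) =
      Submodule.span F {![b 0, b 1, 0, 0], b} := by
  ext x
  rw [Submodule.mem_orthogonalBilin_iff]
  constructor
  · intro hx
    have hux : σ (b 0) * x 0 + σ (b 1) * x 1 = 0 := by
      simpa [hermitianPairing_apply, Fin.sum_univ_four] using
        hx ![b 0, b 1, 0, 0] (Submodule.subset_span (by simp))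
    have hbx : σ (b 2) * x 2 + σ (b 3) * x 3 = 0 := by
      have := hx b (Submodule.subset_span (by simp))
      rw [hermitianPairing_apply, Fin.sum_univ_four] at this
      linear_combination this - hux
    have hx0 : x 0 = x 1 / b 1 * b 0 := eq_div_mul_of_isotropic h1 h01 hux
    have hx2 : x 2 = x 3 / b 3 * b 2 := eq_div_mul_of_isotropic h3 h23 hbx
    refine Submodule.mem_span_pair.2 ⟨x 1 / b 1 - x 3 / b 3, x 3 / b 3, ?_⟩
    ext i
    fin_cases i <;> simp [hx0, hx2, h1, h3, sub_mul]
  · intro hx y hy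
    obtain ⟨a, c, rfl⟩ := Submodule.mem_span_pair.1 hx
    obtain ⟨a', c', rfl⟩ := Submodule.mem_span_pair.1 hy
    have huu : hermitianPairing σ ![b 0, b 1, 0, 0] ![b 0, b 1, 0, 0] = 0 := by
      simpa [hermitianPairing_apply, Fin.sum_univ_four] using h01
    have hub : hermitianPairing σ ![b 0, b 1, 0, 0] b = 0 := by
      simpa [hermitianPairing_apply, Fin.sum_univ_four] using h01
    have hbu : hermitianPairing σ b ![b 0, b 1, 0, 0] = 0 := by
      simpa [hermitianPairing_apply, Fin.sum_univ_four] using h01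
    have hbb : hermitianPairing σ b b = 0 := by
      rw [hermitianPairing_apply, Fin.sum_univ_four]
      linear_combination h01 + h23
    simp only [map_add, LinearMap.map_smulₛₗ, LinearMap.add_apply, LinearMap.smul_apply, huu, hub,
      hbu, hbb, smul_zero, add_zero]

variable [Finite F] {r h : ℕ}

theorem hermitianPairing_conj_self (hF : Nat.card F = r ^ 2) {ι : Type*} [Fintype ι] (x : ι → F) :
    hermitianPairing (conj hF) x x = ∑ i, x i ^ (r + 1) := by
  simp only [hermitianPairing_apply, pow_succ_eq_conj_mul hF]

theorem ncard_points_hermitian_zeros_le (hF : Nat.card F = r ^ 2) (hh : h < r + 1)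
    {f : MvPolynomial (Fin 4) F} (hf : f.IsHomogeneous h) (hf0 : f ≠ 0) :
    (points F {x : Fin 4 → F | ∑ i, x i ^ (r + 1) = 0 ∧ MvPolynomial.eval x f = 0}).ncard ≤
      h * (r + 1) * (r ^ 2 + 1) := by
  obtain ⟨b, h1, h01, h3, h23, hfb⟩ := exists_eval_ne_zero hF hh hf.totalDegree_le hf0
  simp only [pow_succ_eq_conj_mul hF] at h01 h23
  have hrefl := (isSymm_hermitianPairing (ι := Fin 4) (conj_involutive hF)).isRefl
  simp only [← hermitianPairing_conj_self hF, ← hF]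
  exact ncard_points_isotropic_zeros_le (two_le_of_card_eq_sq hF) (conj_apply hF) hrefl
    (orthogonalBilin_span_pair_eq h1 h01 h3 h23) rfl hf hfb

end HermitianPairing

section Codes

theorem finrank_homogeneousSubmodule (R σ : Type*) [CommRing R] [Nontrivial R] [Fintype σ]
    (h : ℕ) :
    Module.finrank R (MvPolynomial.homogeneousSubmodule σ R h) =
      (Fintype.card σ + h - 1).choose h := by
  classical
  have hset : {d : σ →₀ ℕ | d.degree = h} = ↑((Finset.univ : Finset σ).finsuppAntidiag h) := by
    ext d
    simp [Finsupp.degree_eq_sum]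
  rw [MvPolynomial.homogeneousSubmodule_eq_finsupp_supported,
    (AddMonoidAlgebra.supportedEquivFinsupp _).finrank_eq, hset, Module.finrank_finsupp_self]
  simp [Finset.card_finsuppAntidiag_nat_eq_choose]

theorem mem_evalCode {F σ ι : Type*} [Field F] {h : ℕ} {v : ι → σ → F} {x : ι → F} :
    x ∈ evalCode h v ↔ ∃ f : MvPolynomial σ F, f.IsHomogeneous h ∧
      (fun P => MvPolynomial.eval (v P) f) = x :=
  Iff.rfl

theorem card_le_minDist_add {F ι : Type*} [Field F] [Finite ι] {C : Submodule F (ι → F)} {m : ℕ}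
    (hC : C ≠ ⊥) (hm : ∀ x ∈ C, x ≠ 0 → {i | x i = 0}.ncard ≤ m) :
    Nat.card ι ≤ minDist C + m := by
  classical
  let := Fintype.ofFinite ι
  obtain ⟨z, hz, hz0⟩ := Submodule.exists_mem_ne_zero_of_ne_bot hC
  obtain ⟨x, hx, y, hy, hxy, hd⟩ : minDist C ∈
      {d | ∃ x ∈ C, ∃ y ∈ C, x ≠ y ∧ hammingDist x y = d} :=
    Nat.sInf_mem ⟨_, z, hz, 0, zero_mem _, hz0, rfl⟩
  have hzeros := hm (x - y) (sub_mem hx hy) (sub_ne_zero.2 hxy)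
  have hdist : hammingDist x y = {i | (x - y) i = 0}ᶜ.ncard := by
    rw [hammingDist, Set.ncard_eq_toFinset_card']
    simp [sub_eq_zero]
  rw [← Set.ncard_add_ncard_compl {i | (x - y) i = 0}, ← hd, hdist]
  omega

variable {F : Type*} [Field F] [Finite F] {r h : ℕ} {v : rationalPoints F r → Fin 4 → F}
  {f : MvPolynomial (Fin 4) F}

theorem exists_eval_coordinates_ne_zero (hF : Nat.card F = r ^ 2) (hh : h < r + 1)
    (hv : IsCoordinateChoice (rationalPoints F r) v) (hf : f.IsHomogeneous h) (hf0 : f ≠ 0) :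
    ∃ P, MvPolynomial.eval (v P) f ≠ 0 := by
  obtain ⟨b, hb1, hb01, -, hb23, hfb⟩ := exists_eval_ne_zero hF hh hf.totalDegree_le hf0
  have hb0 : b ≠ 0 := fun h0 => hb1 (congrFun h0 1)
  have hbX : mk F b hb0 ∈ rationalPoints F r := by
    rw [rationalPoints_eq_points]
    refine mem_points.2 ⟨b, ?_, hb0, rfl⟩
    rw [Set.mem_ofPred_eq, Fin.sum_univ_four, hb01, zero_add, hb23]
  obtain ⟨hv0, hvb⟩ := hv ⟨mk F b hb0, hbX⟩
  obtain ⟨a, hab⟩ := (mk_eq_mk_iff' F b _ hb0 hv0).1 hvb.symm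
  refine ⟨⟨mk F b hb0, hbX⟩, fun h0 => hfb ?_⟩
  rw [← hab, eval_smul_of_isHomogeneous hf, h0, mul_zero]

theorem finrank_evalCode (hF : Nat.card F = r ^ 2) (hh : h < r + 1)
    (hv : IsCoordinateChoice (rationalPoints F r) v) :
    Module.finrank F (evalCode h v) = (3 + h).choose h := by
  have hinj : Function.Injective
      ((evalMap v).domRestrict (MvPolynomial.homogeneousSubmodule (Fin 4) F h)) := by
    rw [injective_iff_map_eq_zero]
    rintro ⟨f, hf⟩ h0
    by_contra hne
    obtain ⟨P, hP⟩ :=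
      exists_eval_coordinates_ne_zero hF hh hv hf fun hf0 => hne (Subtype.ext hf0)
    exact hP (congrFun h0 P)
  rw [evalCode, ← LinearMap.range_domRestrict, LinearMap.finrank_range_of_inj hinj,
    finrank_homogeneousSubmodule, Fintype.card_fin, show 4 + h - 1 = 3 + h by omega]

theorem ncard_zeros_evalCode_le (hF : Nat.card F = r ^ 2) (hh : h < r + 1)
    (hv : IsCoordinateChoice (rationalPoints F r) v) {x : rationalPoints F r → F}
    (hx : x ∈ evalCode h v) (hx0 : x ≠ 0) :
    {P | x P = 0}.ncard ≤ h * (r + 1) * (r ^ 2 + 1) := by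
  obtain ⟨f, hf, rfl⟩ := mem_evalCode.1 hx
  have hf0 : f ≠ 0 := by
    rintro rfl
    exact hx0 (funext fun P => map_zero _)
  rw [← Set.ncard_image_of_injective _ Subtype.val_injective]
  refine (Set.ncard_le_ncard ?_).trans (ncard_points_hermitian_zeros_le hF hh hf hf0)
  rintro _ ⟨P, hP, rfl⟩
  obtain ⟨hv0, hvP⟩ := hv P
  refine mem_points.2 ⟨v P, ⟨?_, hP⟩, hv0, hvP⟩
  simpa [hermitianForm] using P.2 (v P) hv0 hvP

theorem le_minDist_evalCode (hF : Nat.card F = r ^ 2) (hh : h < r + 1)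
    (hv : IsCoordinateChoice (rationalPoints F r) v) :
    (Nat.card (rationalPoints F r) : ℤ) - h * (r + 1) * (r ^ 2 + 1) ≤ minDist (evalCode h v) := by
  have hC : evalCode h v ≠ ⊥ := by
    intro hbot
    have hk := finrank_evalCode hF hh hv
    rw [hbot, finrank_bot] at hk
    exact (Nat.choose_pos (Nat.le_add_left h 3)).ne hk
  have hd := card_le_minDist_add hC fun x => ncard_zeros_evalCode_le hF hh hv
  rw [sub_le_iff_le_add]
  exact_mod_cast hd

end Codes

end HermitianSurfaceCode

theorem mainTheorem6 (r h : ℕ) (F : Type*) [Field F] [Finite F] (hF : Nat.card F = r ^ 2)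
    (hh : h < r + 1)
    (v : HermitianSurfaceCode.rationalPoints F r → Fin 4 → F)
    (hv : HermitianSurfaceCode.IsCoordinateChoice (HermitianSurfaceCode.rationalPoints F r) v) :
    Nat.card (HermitianSurfaceCode.rationalPoints F r) = (r ^ 2 + 1) * (r ^ 3 + 1) ∧
    Module.finrank F (HermitianSurfaceCode.evalCode h v) = Nat.choose (3 + h) h ∧
    (Nat.card (HermitianSurfaceCode.rationalPoints F r) : ℤ) - h * (r + 1) * (r ^ 2 + 1) ≤
      (HermitianSurfaceCode.minDist (HermitianSurfaceCode.evalCode h v) : ℤ) :=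
  ⟨HermitianSurfaceCode.card_rationalPoints hF, HermitianSurfaceCode.finrank_evalCode hF hh hv,
    HermitianSurfaceCode.le_minDist_evalCode hF hh hv⟩
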